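/- Let $\vec r=(r_1,r_2,\dots)$ be a sequence of positive integers. Define groups recursively by letting $W(\vec r|_0)$ be trivial and $W(\vec r|_k)=W(\vec r|_{k-1})\wr\mathbb Z_{r_k}=W(\vec r|_{k-1})^{r_k}\rtimes\mathbb Z_{r_k}$, where the cyclic group $\mathbb Z_{r_k}=\mathbb Z/r_k\mathbb Z$ acts by rotating the $r_k$ coordinates. A traversal for a finite group $G$ is a family of irreducible complex representations of $G$ containing exactly one representation from each isomorphism class of irreducible complex representations. Let $k\ge 1$ and let $\{\rho_1,\dots,\rho_h\}$ be a traversal for $W(\vec r|_{k-1})$. Let $\mathbb Z_{r_k}$ act on the set of words $[h]^{r_k}$ by rotation, $(x_1\cdots x_{r_k})^i=x_{i+1}\cdots x_{r_k}x_1\cdots x_i$, and let $J\subseteq[h]^{r_k}$ be a set of orbit representatives, so that $[h]^{r_k}$ is the disjoint union of the orbits of the elements of $J$. For a word $x$ let $d_x=\min\{i\ge 1: x^i=x\}$ be its period, and let $S_x=d_x\mathbb Z/r_k\mathbb Z\le\mathbb Z_{r_k}$ be the subgroup generated by $d_x$, i.e. the stabilizer of $x$, which is cyclic of order $r_k/d_x$.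 For a character $\tau: S_x\to\mathbb C^\times$, let $\rho_{x_1}\otimes\cdots\otimes\rho_{x_{r_k}}\otimes\tau$ denote the representation of $W(\vec r|_{k-1})^{r_k}\rtimes S_x$ on the tensor product of the spaces of the $\rho_{x_j}$ in which $W(\vec r|_{k-1})^{r_k}$ acts factorwise and $s\in S_x$ acts by $\tau(s)$ times the corresponding rotation of the tensor factors. Then the family $$\operatorname{Ind}_{W(\vec r|_{k-1})^{r_k}\rtimes S_x}^{W(\vec r|_k)}\bigl(\rho_{x_1}\otimes\cdots\otimes\rho_{x_{r_k}}\otimes\tau\bigr),\qquad x\in J,\ \tau\in\operatorname{Hom}(S_x,\mathbb C^\times),$$ is a traversal for $W(\vec r|_k)$: its members are irreducible, members with different indices $(x,\tau)$ are not isomorphic, and every irreducible complex representation of $W(\vec r|_k)$ is isomorphic to a member. -/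

import Mathlib

open scoped TensorProduct

noncomputable section

namespace CyclicWreath

universe u

/-- The cyclic group of order `n` (for `n` positive), written multiplicatively.
Its elements also index the `n` positions of a word of length `n`. -/
abbrev Cyc (n : ℕ) : Type := Multiplicative (ZMod n)

/-- The generalized iterated wreath product: `W r 0` is trivial and
`W r (k + 1) = W r k ≀ ℤ/r_{k+1}`, where the cyclic group permutes the `r_{k+1}` coordinates by
rotation (the regular action). The value `r 0` plays no role. -/
def W (r : ℕ → ℕ+) : ℕ → Type
  | 0 => PUnit
  | k + 1 => W r k ≀ᵣ Cyc (r (k + 1))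

instance instGroupW (r : ℕ → ℕ+) : (k : ℕ) → Group (W r k)
  | 0 => (inferInstance : Group PUnit)
  | k + 1 => @RegularWreathProduct.instGroup (W r k) (Cyc (r (k + 1))) (instGroupW r k) _

/-- A family of complex representations of `G` is a traversal if every member is irreducible,
members with different indices are not isomorphic, and every irreducible representation of `G` is
isomorphic to a member. -/
def IsTraversal {G : Type} [Group G] {ι : Type} {V : ι → Type u} [∀ i, AddCommGroup (V i)]
    [∀ i, Module ℂ (V i)] (ρ : ∀ i, Representation ℂ G (V i)) : Prop :=
  (∀ i, (ρ i).IsIrreducible) ∧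
  (∀ i j, Nonempty ((ρ i).Equiv (ρ j)) → i = j) ∧
  ∀ (U : Type u) [AddCommGroup U] [Module ℂ U] (σ : Representation ℂ G U),
    σ.IsIrreducible → ∃ i, Nonempty (σ.Equiv (ρ i))

section Words

variable {ι : Type} {n : ℕ}

/-- Rotation of words: the letter of `x ^ q` at position `j` is the letter of `x` at
position `j + q`, positions being read modulo `n`. -/
def rotate (q : Cyc n) (x : Cyc n → ι) : Cyc n → ι := fun j => x (j * q)

/-- The orbit of a word under rotations. -/
def orbit (x : Cyc n → ι) : Set (Cyc n → ι) := Set.range fun q => rotate q x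

/-- `J` is a set of representatives: the set of all words is the disjoint union of the orbits
of the elements of `J`. -/
def IsOrbitReps (J : Set (Cyc n → ι)) : Prop :=
  (⋃ x ∈ J, orbit x) = Set.univ ∧ J.PairwiseDisjoint orbit

/-- The period `d_x`: the least positive integer `i` with `x ^ i = x`. -/
def period (x : Cyc n → ι) : ℕ :=
  sInf {i : ℕ | 0 < i ∧ rotate (Multiplicative.ofAdd (i : ZMod n)) x = x}

/-- The subgroup of the cyclic group generated by the class of the period `d_x`. It is the
stabilizer of `x` (`mem_stab_iff`) and is cyclic of order `n / d_x` (`card_stab`). -/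
def stab (x : Cyc n → ι) : Subgroup (Cyc n) :=
  Subgroup.zpowers (Multiplicative.ofAdd (period x : ZMod n))

theorem rotate_one (x : Cyc n → ι) : rotate 1 x = x := by
  funext j
  simp [rotate]

theorem rotate_mul (q q' : Cyc n) (x : Cyc n → ι) :
    rotate (q * q') x = rotate q (rotate q' x) := by
  funext j
  simp [rotate, mul_assoc]

theorem period_spec [NeZero n] (x : Cyc n → ι) :
    0 < period x ∧ rotate (Multiplicative.ofAdd (period x : ZMod n)) x = x := by
  refine Nat.sInf_mem (s := {i : ℕ | 0 < i ∧
    rotate (Multiplicative.ofAdd (i : ZMod n)) x = x}) ⟨n, Nat.pos_of_neZero n, ?_⟩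
  simp [rotate_one]

/-- The stabilizer of a word, as a subgroup. -/
def fixer (x : Cyc n → ι) : Subgroup (Cyc n) where
  carrier := {q | rotate q x = x}
  one_mem' := rotate_one x
  mul_mem' {a b} ha hb := by
    change rotate (a * b) x = x
    rw [rotate_mul, show rotate b x = x from hb, show rotate a x = x from ha]
  inv_mem' {a} ha := by
    change rotate a⁻¹ x = x
    conv_lhs => rw [← show rotate a x = x from ha]
    rw [← rotate_mul, inv_mul_cancel, rotate_one]

theorem stab_eq_fixer [NeZero n] (x : Cyc n → ι) : stab x = fixer x := by
  have hd := period_spec x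
  apply le_antisymm
  · exact (Subgroup.zpowers_le).2 hd.2
  · intro q hq
    obtain ⟨m, rfl⟩ : ∃ m : ℕ, q = Multiplicative.ofAdd (m : ZMod n) :=
      ⟨(Multiplicative.toAdd q).val, by simp⟩
    have hdm : Multiplicative.ofAdd (period x : ZMod n) ∈ fixer x := hd.2
    have hsplit : Multiplicative.ofAdd (m : ZMod n) =
        Multiplicative.ofAdd ((m % period x : ℕ) : ZMod n) *
          Multiplicative.ofAdd (period x : ZMod n) ^ (m / period x) := by
      rw [← ofAdd_nsmul, ← ofAdd_add, nsmul_eq_mul]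
      congr 1
      rw [← Nat.cast_mul, ← Nat.cast_add, mul_comm, Nat.mod_add_div]
    have hpow := (fixer x).pow_mem hdm (m / period x)
    have hmod : Multiplicative.ofAdd ((m % period x : ℕ) : ZMod n) ∈ fixer x := by
      rw [hsplit] at hq
      exact ((fixer x).mul_mem_cancel_right hpow).1 hq
    have hzero : m % period x = 0 := by
      by_contra hne
      have hle : period x ≤ m % period x := Nat.sInf_le ⟨Nat.pos_of_ne_zero hne, hmod⟩
      exact absurd (Nat.mod_lt m hd.1) (not_lt.2 hle)
    rw [hsplit, hzero]
    simp only [Nat.cast_zero, ofAdd_zero, one_mul]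
    exact Subgroup.npow_mem_zpowers _ _

theorem mem_stab_iff [NeZero n] (x : Cyc n → ι) (q : Cyc n) : q ∈ stab x ↔ rotate q x = x := by
  rw [stab_eq_fixer]
  rfl

theorem period_dvd [NeZero n] (x : Cyc n → ι) : period x ∣ n := by
  have hd := period_spec x
  by_contra hnd
  have hne : n % period x ≠ 0 := fun h => hnd (Nat.dvd_of_mod_eq_zero h)
  have hmem : Multiplicative.ofAdd ((n % period x : ℕ) : ZMod n) ∈ stab x := by
    have h0 : ((n % period x : ℕ) : ZMod n) + (n / period x : ℕ) • (period x : ZMod n) = 0 := by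
      rw [nsmul_eq_mul, ← Nat.cast_mul, ← Nat.cast_add, mul_comm, Nat.mod_add_div]
      simp
    rw [eq_neg_of_add_eq_zero_left h0, ofAdd_neg, ofAdd_nsmul]
    exact (stab x).inv_mem (Subgroup.npow_mem_zpowers _ _)
  have hle : period x ≤ n % period x :=
    Nat.sInf_le ⟨Nat.pos_of_ne_zero hne, (mem_stab_iff x _).1 hmem⟩
  exact absurd (Nat.mod_lt n hd.1) (not_lt.2 hle)

theorem card_stab [NeZero n] (x : Cyc n → ι) : Nat.card (stab x) = n / period x := by
  rw [stab, Nat.card_zpowers, orderOf_ofAdd_eq_addOrderOf,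
    ZMod.addOrderOf_coe _ (NeZero.ne n), Nat.gcd_eq_right (period_dvd x)]

theorem apply_inv_mul [NeZero n] {x : Cyc n → ι} {q : Cyc n} (hq : q ∈ stab x) (j : Cyc n) :
    x (q⁻¹ * j) = x j := by
  have h := (mem_stab_iff x _).1 ((stab x).inv_mem hq)
  rw [mul_comm]
  exact congrFun h j

end Words

section Rep

variable {D : Type} [Group D] {ι : Type} {n : ℕ}
  {V : ι → Type u} [∀ i, AddCommGroup (V i)] [∀ i, Module ℂ (V i)]

/-- The subgroup `D^n ⋊ S_x` of `D ≀ ℤ/n`, where `S_x` is the stabilizer of `x`. -/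
def inertia (D : Type) [Group D] (x : Cyc n → ι) : Subgroup (D ≀ᵣ Cyc n) :=
  (stab x).comap RegularWreathProduct.rightHom

/-- The projection `D^n ⋊ S_x → S_x`. -/
def inertiaProj (D : Type) [Group D] (x : Cyc n → ι) : inertia D x →* stab x :=
  (RegularWreathProduct.rightHom.comp (inertia D x).subtype).codRestrict (stab x) fun g => g.2

theorem cast_comm (ρ : ∀ i, Representation ℂ D (V i)) {i j : ι} (h : i = j) (a : D) (v : V i) :
    LinearEquiv.cast (R := ℂ) (M := V) h (ρ i a v) =
      ρ j a (LinearEquiv.cast (R := ℂ) (M := V) h v) := by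
  subst h
  rfl

theorem cast_self (x : Cyc n → ι) (v : ∀ j, V (x j)) {a b : Cyc n} (e : a = b)
    (h : x a = x b) : LinearEquiv.cast (R := ℂ) (M := V) h (v a) = v b := by
  subst e
  rfl

theorem cast_cast (x : Cyc n → ι) (v : ∀ j, V (x j)) {a b : Cyc n} {i j : ι} (e : a = b)
    (h₁ : x a = i) (h₂ : i = j) (h₃ : x b = j) :
    LinearEquiv.cast (R := ℂ) (M := V) h₂ (LinearEquiv.cast (R := ℂ) (M := V) h₁ (v a)) =
      LinearEquiv.cast (R := ℂ) (M := V) h₃ (v b) := by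
  subst e h₁ h₂
  rfl

variable [NeZero n]

theorem inertia_apply {x : Cyc n → ι} (g : inertia D x) (j : Cyc n) :
    x (g.1.right⁻¹ * j) = x j :=
  apply_inv_mul (q := g.1.right) g.2 j

/-- The operator on `⨂_j V (x j)` given by an element `(a, q)` of `D^n ⋊ S_x`: the factor at
position `q⁻¹ * j` is moved to position `j` (the letters of `x` there agree), and then `a j` acts
on it; see `tensorOp_tprod`. -/
def tensorOp (ρ : ∀ i, Representation ℂ D (V i)) (x : Cyc n → ι) (g : inertia D x) :
    (⨂[ℂ] j, V (x j)) →ₗ[ℂ] ⨂[ℂ] j, V (x j) :=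
  PiTensorProduct.map (fun j => ρ (x j) (g.1.left j) ∘ₗ
      (LinearEquiv.cast (R := ℂ) (M := V) (i := x ((Equiv.mulLeft g.1.right).symm j))
        (inertia_apply g j)).toLinearMap) ∘ₗ
    (PiTensorProduct.reindex ℂ (fun j => V (x j)) (Equiv.mulLeft g.1.right)).toLinearMap

theorem tensorOp_tprod (ρ : ∀ i, Representation ℂ D (V i)) (x : Cyc n → ι) (g : inertia D x)
    (v : ∀ j, V (x j)) :
    tensorOp ρ x g (PiTensorProduct.tprod ℂ v) = PiTensorProduct.tprod ℂ fun j =>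
      ρ (x j) (g.1.left j) (LinearEquiv.cast (R := ℂ) (M := V) (inertia_apply g j)
        (v (g.1.right⁻¹ * j))) := by
  rw [tensorOp, LinearMap.comp_apply, LinearEquiv.coe_coe, PiTensorProduct.reindex_tprod,
    PiTensorProduct.map_tprod]
  rfl

/-- The representation `ρ_{x_1} ⊗ ⋯ ⊗ ρ_{x_n}` of `D^n`, extended to `D^n ⋊ S_x` by letting
`S_x` permute the tensor factors. -/
def tensorRep (ρ : ∀ i, Representation ℂ D (V i)) (x : Cyc n → ι) :
    Representation ℂ (inertia D x) (⨂[ℂ] j, V (x j)) where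
  toFun := tensorOp ρ x
  map_one' := by
    refine PiTensorProduct.ext (MultilinearMap.ext fun v => ?_)
    rw [LinearMap.compMultilinearMap_apply, tensorOp_tprod]
    refine congrArg (PiTensorProduct.tprod ℂ) (funext fun j => ?_)
    rw [cast_self x v (b := j) (by simp)]
    simp
  map_mul' g g' := by
    refine PiTensorProduct.ext (MultilinearMap.ext fun v => ?_)
    rw [LinearMap.compMultilinearMap_apply, LinearMap.compMultilinearMap_apply,
      Module.End.mul_apply, tensorOp_tprod, tensorOp_tprod, tensorOp_tprod]
    refine congrArg (PiTensorProduct.tprod ℂ) (funext fun j => ?_)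
    rw [cast_comm, cast_cast x v (b := (g * g').1.right⁻¹ * j)
      (by simp [mul_assoc, mul_comm]) _ _ (inertia_apply (g * g') j),
      ← Module.End.mul_apply, ← map_mul]
    simp

/-- The representation `ρ_{x_1} ⊗ ⋯ ⊗ ρ_{x_n} ⊗ τ` of `D^n ⋊ S_x`, where the character `τ` of
`S_x` is inflated along the projection to `S_x`; the one-dimensional factor is absorbed as
multiplication by scalars. -/
def twistedRep (ρ : ∀ i, Representation ℂ D (V i)) (x : Cyc n → ι) (τ : stab x →* ℂˣ) :
    Representation ℂ (inertia D x) (⨂[ℂ] j, V (x j)) where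
  toFun g := (τ (inertiaProj D x g) : ℂ) • tensorRep ρ x g
  map_one' := by simp
  map_mul' g g' := by
    simp only [map_mul, Units.val_mul]
    rw [smul_mul_smul_comm]

/-- `Ind (ρ_{x_1} ⊗ ⋯ ⊗ ρ_{x_n} ⊗ τ)` from `D^n ⋊ S_x` to `D ≀ ℤ/n`. -/
def inducedRep (ρ : ∀ i, Representation ℂ D (V i)) (x : Cyc n → ι) (τ : stab x →* ℂˣ) :
    Representation ℂ (D ≀ᵣ Cyc n)
      (Representation.IndV (inertia D x).subtype (twistedRep ρ x τ)) :=
  Representation.ind (inertia D x).subtype (twistedRep ρ x τ)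

end Rep

end CyclicWreath

end

/-!
The base group `D^n` is studied through matrix coefficients. For an irreducible representation `V`
of the finite group `D`, a functional `φ` and a vector `w`, the function
`d ↦ (dim V / |D|) φ (d⁻¹ w)` acts on `V` as the rank one operator `v ↦ φ v • w` and on every
irreducible representation not isomorphic to `V` as zero (`funAct_matCoeff_self`,
`funAct_matCoeff_of_not_equiv`: Schur orthogonality). For a traversal these functions span all
functions on `D` (`span_matCoeff`). A family of such coefficients, one for each letter of a word
`x`, gives an operator `E = E(x, φ, w)` on every representation of `D^n`. Since the delta function
at the identity is a combination of coefficients, on a nonzero representation some `E` is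
nonzero (`exists_wordCoeff_ne_zero`).

Let `T_x` be the tensor product of the `V (x j)` and let `Ind (x, τ)` be the induced
representation, which is the direct sum of translates of `T_x` by rotations modulo the stabilizer.
On `Ind (y, τ)` the operator `E(x, φ, w)` vanishes unless `y` is a rotation of `x`
(`powAct_wordCoeff_of_notMem_orbit`). On `Ind (x, τ)` it has image in the line of the pure tensor
`w` in the summand of the identity coset (`powAct_wordCoeff_mem_span`) and sends the pure
tensor `v` of that summand to `(∏ φ_j (v_j)) • w` (`powAct_wordCoeff_mk_one`).

* Irreducibility: on a nonzero subrepresentation some `E(y, φ, w)` with `y ∈ J` is nonzero after a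
  translation, so `y = x` and the subrepresentation contains a nonzero pure tensor `w` of the
  identity summand. Other operators `E(x, φ', v)` turn it into all pure tensors, which generate.
* Distinctness: an isomorphism commutes with all `E`, which forces `x = y` and then a scalar on the
  identity summand. Comparing the two actions of the stabilizer there gives equality of characters.
* Exhaustion: if `E(x, φ, w) u ≠ 0`, then `w ↦ E(x, φ, w) u` is a nonzero `D^n`-equivariant map
  out of `T_x`. Averaging it over `D^n ⋊ S_x` against a character `τ` gives an equivariant map out
  of `T_x ⊗ τ`, and by orthogonality of characters not all of these averages vanish. Frobenius
  reciprocity and irreducibility turn a nonvanishing one into an isomorphism from `Ind (x, τ)`.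
-/

noncomputable section

namespace CyclicWreath

universe u

/-! ### Matrix coefficients of one finite group -/

section FiniteGroup

open scoped MonoidAlgebra

variable {D : Type} [Group D]

theorem exists_ne_zero_of_isIrreducible {V : Type*} [AddCommGroup V] [Module ℂ V]
    (ρ : Representation ℂ D V) (h : ρ.IsIrreducible) : ∃ v : V, v ≠ 0 := by
  by_contra! hall
  refine bot_ne_top (α := Subrepresentation ρ) (SetLike.ext fun v => ?_)
  rw [hall v]
  exact ⟨fun _ => trivial, fun _ => (⊥ : Subrepresentation ρ).toSubmodule.zero_mem⟩

/-- The orbit of a nonzero vector is finite and spans. -/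
theorem finiteDimensional_of_isIrreducible [Finite D] {V : Type*} [AddCommGroup V] [Module ℂ V]
    (ρ : Representation ℂ D V) (h : ρ.IsIrreducible) : FiniteDimensional ℂ V := by
  obtain ⟨v, hv⟩ := exists_ne_zero_of_isIrreducible ρ h
  let S : Subrepresentation ρ :=
    { toSubmodule := Submodule.span ℂ (Set.range fun d => ρ d v)
      apply_mem_toSubmodule := fun g w hw => by
        induction hw using Submodule.span_induction with
        | mem w hw =>
          obtain ⟨d, rfl⟩ := hw
          refine Submodule.subset_span ⟨g * d, ?_⟩
          simp
        | zero => simp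
        | add a b _ _ ha hb => rw [map_add]; exact add_mem ha hb
        | smul c a _ ha => rw [map_smul]; exact Submodule.smul_mem _ _ ha }
  have hS : S = ⊤ := by
    refine (IsSimpleOrder.eq_bot_or_eq_top S).resolve_left fun hb => hv ?_
    have : v ∈ S := Submodule.subset_span ⟨1, by simp⟩
    rw [hb] at this
    exact this
  refine ⟨?_⟩
  have : (⊤ : Submodule ℂ V) = Submodule.span ℂ (Set.range fun d => ρ d v) :=
    (congrArg Subrepresentation.toSubmodule hS).symm
  rw [this]
  exact Submodule.fg_span (Set.finite_range _)

variable [Fintype D]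

/-- The operator `∑ d, c d • π d` by which a function `c` on `D` acts on a representation. -/
def funAct {U : Type*} [AddCommGroup U] [Module ℂ U] (π : Representation ℂ D U) (c : D → ℂ) :
    U →ₗ[ℂ] U := ∑ d, c d • π d

/-- The matrix coefficient `d ↦ φ (d⁻¹ w)`, normalised by `dim V / |D|`. -/
def matCoeff {V : Type*} [AddCommGroup V] [Module ℂ V] (ρ : Representation ℂ D V)
    (φ : Module.Dual ℂ V) : V →ₗ[ℂ] (D → ℂ) :=
  ((Module.finrank ℂ V : ℂ) / Fintype.card D) • LinearMap.pi fun d => φ ∘ₗ ρ d⁻¹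

section
variable {V W : Type*} [AddCommGroup V] [Module ℂ V] [AddCommGroup W] [Module ℂ W]
  (ρ : Representation ℂ D V) (σ : Representation ℂ D W)

theorem matCoeff_apply (φ : Module.Dual ℂ V) (w : V) (d : D) :
    matCoeff ρ φ w d = ((Module.finrank ℂ V : ℂ) / Fintype.card D) * φ (ρ d⁻¹ w) := rfl

theorem funAct_apply (c : D → ℂ) (v : V) : funAct ρ c v = ∑ d, c d • ρ d v := by
  simp [funAct, LinearMap.sum_apply]

/-- The sum over the group of the conjugates of the rank one map `w ↦ φ w • v`. -/
def avgRankOne (φ : Module.Dual ℂ V) (v : W) : Representation.IntertwiningMap ρ σ :=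
  LinearMap.intertwiningMap_of_isIntertwiningMap ρ σ
    (∑ d, (φ ∘ₗ ρ d⁻¹).smulRight (σ d v)) fun g w => by
      simp only [LinearMap.sum_apply, LinearMap.smulRight_apply, LinearMap.comp_apply, map_sum,
        map_smul]
      refine Fintype.sum_equiv (Equiv.mulLeft g⁻¹) _ _ fun d => ?_
      simp [← Module.End.mul_apply, ← map_mul]

theorem avgRankOne_apply (φ : Module.Dual ℂ V) (v : W) (w : V) :
    avgRankOne ρ σ φ v w = ∑ d, φ (ρ d⁻¹ w) • σ d v := by
  change (∑ d, (φ ∘ₗ ρ d⁻¹).smulRight (σ d v)) w = _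
  simp [LinearMap.sum_apply]

theorem funAct_matCoeff (φ : Module.Dual ℂ V) (w : V) (v : W) :
    funAct σ (matCoeff ρ φ w) v =
      ((Module.finrank ℂ V : ℂ) / Fintype.card D) • avgRankOne ρ σ φ v w := by
  simp_rw [funAct_apply, avgRankOne_apply, matCoeff_apply, Finset.smul_sum, smul_smul]

/-- Schur orthogonality, off the diagonal. -/
theorem funAct_matCoeff_of_not_equiv (hρ : ρ.IsIrreducible) (hσ : σ.IsIrreducible)
    (h : ¬ Nonempty (ρ.Equiv σ)) (φ : Module.Dual ℂ V) (w : V) (v : W) :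
    funAct σ (matCoeff ρ φ w) v = 0 := by
  have : IsEmpty (ρ.Equiv σ) := not_nonempty_iff.1 h
  rw [funAct_matCoeff, Subsingleton.elim (avgRankOne ρ σ φ v) 0]
  simp

/-- Schur orthogonality, on the diagonal: the normalised matrix coefficient acts as the rank one
operator `v ↦ φ v • w`. -/
theorem funAct_matCoeff_self (hρ : ρ.IsIrreducible) (φ : Module.Dual ℂ V) (w v : V) :
    funAct ρ (matCoeff ρ φ w) v = φ v • w := by
  have := finiteDimensional_of_isIrreducible ρ hρ
  obtain ⟨c, hc⟩ :=
    (Representation.IsIrreducible.algebraMap_intertwiningMap_bijective_of_isAlgClosed (ρ := ρ)).2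
      (avgRankOne ρ ρ φ v)
  have hc' : ∀ w, avgRankOne ρ ρ φ v w = c • w := fun w => by rw [← hc]; rfl
  -- The scalar is found by comparing traces.
  have htr := congrArg (LinearMap.trace ℂ V) (LinearMap.ext hc' :
    (avgRankOne ρ ρ φ v).toLinearMap = c • LinearMap.id)
  have h1 : LinearMap.trace ℂ V (avgRankOne ρ ρ φ v).toLinearMap = Fintype.card D * φ v := by
    change LinearMap.trace ℂ V (∑ d, (φ ∘ₗ ρ d⁻¹).smulRight (ρ d v)) = _
    rw [map_sum]
    simp [LinearMap.trace_smulRight, ← Module.End.mul_apply, ← map_mul]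
  rw [h1, map_smul, LinearMap.trace_id, smul_eq_mul] at htr
  have hD : (Fintype.card D : ℂ) ≠ 0 := by simp
  rw [funAct_matCoeff, hc', smul_smul]
  congr 1
  field_simp
  linear_combination -htr

theorem matCoeff_map (φ : Module.Dual ℂ V) (w : V) (g d : D) :
    matCoeff ρ φ (ρ g w) d = matCoeff ρ φ w (g⁻¹ * d) := by
  simp [matCoeff_apply, ← Module.End.mul_apply, ← map_mul]

end

/-- The right regular representation on the functions on `D`. The lift puts its
subrepresentations in the universe over which a traversal is tested. -/
def funRep (D : Type) [Group D] : Representation ℂ D (ULift.{u} D → ℂ) where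
  toFun g := LinearMap.funLeft ℂ ℂ fun d => ULift.up (d.down * g)
  map_one' := by ext; simp [LinearMap.funLeft_apply]
  map_mul' g h := by
    refine LinearMap.ext fun f => funext fun d => ?_
    simp [LinearMap.funLeft_apply, mul_assoc]

theorem isIrreducible_toRepresentation_of_isAtom {G W : Type*} [Group G] [AddCommGroup W]
    [Module ℂ W] {π : Representation ℂ G W} {A : Subrepresentation π} (hA : IsAtom A) :
    A.toRepresentation.IsIrreducible := by
  have hne : ∃ a ∈ A, a ≠ 0 := by
    by_contra! h
    exact hA.1 (le_bot_iff.1 fun a ha => h a ha)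
  obtain ⟨a, ha, ha0⟩ := hne
  have hnt : Nontrivial (Subrepresentation A.toRepresentation) :=
    ⟨⊥, ⊤, fun h => ha0 (congrArg Subtype.val (show (⟨a, ha⟩ : A.toSubmodule) = 0 from by
      have : (⟨a, ha⟩ : A.toSubmodule) ∈ (⊤ : Subrepresentation A.toRepresentation) := trivial
      rw [← h] at this
      exact this))⟩
  refine { eq_bot_or_eq_top := fun S => ?_ }
  let S' : Subrepresentation π :=
    { toSubmodule := S.toSubmodule.map A.toSubmodule.subtype
      apply_mem_toSubmodule := by
        rintro g _ ⟨v, hv, rfl⟩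
        exact ⟨A.toRepresentation g v, S.apply_mem_toSubmodule g hv, rfl⟩ }
  have hle : S' ≤ A := fun _ ⟨v, _, hv⟩ => hv ▸ v.2
  rcases hA.le_iff.1 hle with h | h
  · left
    refine le_bot_iff.1 fun v hv => ?_
    have : v.1 ∈ S' := ⟨v, hv, rfl⟩
    rw [h] at this
    exact Subtype.ext this
  · right
    refine top_le_iff.1 fun v _ => ?_
    have : v.1 ∈ S' := by
      rw [h]
      exact v.2
    obtain ⟨w, hw, hwv⟩ := this
    rwa [← Subtype.ext hwv]

/-- The matrix coefficients of a traversal span all functions on the group. -/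
theorem span_matCoeff {ι : Type} {V : ι → Type u} [∀ i, AddCommGroup (V i)]
    [∀ i, Module ℂ (V i)] {ρ : ∀ i, Representation ℂ D (V i)} (hρ : IsTraversal ρ) :
    Submodule.span ℂ {c : D → ℂ | ∃ i φ w, matCoeff (ρ i) φ w = c} = ⊤ := by
  set M := Submodule.span ℂ {c : D → ℂ | ∃ i φ w, matCoeff (ρ i) φ w = c} with hM
  let e : (ULift.{u} D → ℂ) →ₗ[ℂ] (D → ℂ) := LinearMap.funLeft ℂ ℂ fun d => ULift.up d⁻¹
  -- The functions whose reflection lies in `M` form a subrepresentation; an irreducible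
  -- subrepresentation of a complement would consist of matrix coefficients.
  let S : Subrepresentation (funRep.{u} D) :=
    { toSubmodule := M.comap e
      apply_mem_toSubmodule := fun g f hf => by
        let t : (D → ℂ) →ₗ[ℂ] (D → ℂ) := LinearMap.funLeft ℂ ℂ fun d => g⁻¹ * d
        have ht : e (funRep.{u} D g f) = t (e f) := funext fun d => by
          simp [e, t, funRep, LinearMap.funLeft_apply]
        change e (funRep.{u} D g f) ∈ M
        rw [ht]
        have hle : M ≤ M.comap t := by
          rw [hM, Submodule.span_le]
          rintro _ ⟨i, φ, w, rfl⟩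
          exact Submodule.subset_span ⟨i, φ, ρ i g w, funext fun d => matCoeff_map _ _ _ _ _⟩
        exact hle hf }
  have hS : S = ⊤ := by
    obtain ⟨S', hS'⟩ := exists_isCompl S
    have hatomic : IsAtomic (Subrepresentation (funRep.{u} D)) :=
      (OrderIso.isAtomic_iff Subrepresentation.subrepresentationSubmoduleOrderIso).2 inferInstance
    rcases hatomic.eq_bot_or_exists_atom_le S' with h | ⟨A, hA, hAS'⟩
    · rw [h] at hS'
      simpa using hS'.sup_eq_top
    · exfalso
      have hAS : A ≤ S := by
        intro f hf
        obtain ⟨i, ⟨ε⟩⟩ := hρ.2.2 _ _ (isIrreducible_toRepresentation_of_isAtom hA)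
        -- Evaluation at `1` turns the embedding of `V i` into a functional.
        let φ : Module.Dual ℂ (V i) := LinearMap.proj ⟨1⟩ ∘ₗ A.toSubmodule.subtype ∘ₗ
          ε.symm.toLinearMap
        have hD : (Fintype.card D : ℂ) ≠ 0 := by simp
        have hirr := hρ.1 i
        have := finiteDimensional_of_isIrreducible _ hirr
        obtain ⟨v, hv⟩ := exists_ne_zero_of_isIrreducible _ hirr
        have : Nontrivial (V i) := ⟨v, 0, hv⟩
        have hV : (Module.finrank ℂ (V i) : ℂ) ≠ 0 :=
          Nat.cast_ne_zero.2 Module.finrank_pos.ne'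
        have hef : ((Module.finrank ℂ (V i) : ℂ) / Fintype.card D) • e f =
            matCoeff (ρ i) φ (ε ⟨f, hf⟩) := funext fun d => by
          have h1 : ε.symm (ρ i d⁻¹ (ε ⟨f, hf⟩)) = A.toRepresentation d⁻¹ ⟨f, hf⟩ := by
            refine (Representation.IntertwiningMap.isIntertwining _ _
              ε.symm.toIntertwiningMap d⁻¹ _).trans ?_
            exact congrArg _ (ε.toLinearEquiv.symm_apply_apply _)
          have h2 : φ (ρ i d⁻¹ (ε ⟨f, hf⟩)) = f ⟨d⁻¹⟩ := by
            change (ε.symm (ρ i d⁻¹ (ε ⟨f, hf⟩))).1 ⟨1⟩ = _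
            rw [h1]
            change f ⟨1 * d⁻¹⟩ = _
            rw [one_mul]
          rw [matCoeff_apply, h2]
          rfl
        change e f ∈ M
        rw [← Submodule.smul_mem_iff M (div_ne_zero hV hD), hef]
        exact Submodule.subset_span ⟨i, φ, _, rfl⟩
      exact hA.1 (le_bot_iff.1 (hS'.disjoint hAS hAS'))
  rw [eq_top_iff]
  intro c _
  have : (fun d : ULift.{u} D => c d.down⁻¹) ∈ S := hS ▸ trivial
  have : e (fun d : ULift.{u} D => c d.down⁻¹) ∈ M := this
  simpa [e, LinearMap.funLeft, Function.comp_def] using this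

end FiniteGroup

/-! ### Families of functions acting on representations of a power -/

section Power

variable {D : Type} [Group D] [Fintype D] {κ : Type} [Fintype κ] [DecidableEq κ]

/-- A multilinear map vanishing on all families from a spanning set is zero. -/
theorem multilinear_eq_zero_of_span {E F : Type*} [AddCommGroup E] [Module ℂ E] [AddCommGroup F]
    [Module ℂ F] (f : MultilinearMap ℂ (fun _ : κ => E) F) {s : Set E}
    (hs : Submodule.span ℂ s = ⊤) (hf : ∀ c : κ → E, (∀ j, c j ∈ s) → f c = 0) : f = 0 := by
  have key : ∀ (t : Finset κ) (c : κ → E), (∀ j, j ∉ t → c j ∈ s) → f c = 0 := by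
    intro t
    induction t using Finset.induction_on with
    | empty => exact fun c hc => hf c fun j => hc j (by simp)
    | insert i t _ ih =>
      intro c hc
      have hle : Submodule.span ℂ s ≤ LinearMap.ker (f.toLinearMap c i) := by
        rw [Submodule.span_le]
        intro e he
        refine ih _ fun j hj => ?_
        by_cases hij : j = i
        · subst hij
          simpa using he
        · rw [Function.update_of_ne hij]
          exact hc j (by simp [hij, hj])
      have hci : c i ∈ Submodule.span ℂ s := hs ▸ trivial
      simpa using hle hci
  exact MultilinearMap.ext fun c => key Finset.univ c (by simp)

variable {U : Type*} [AddCommGroup U] [Module ℂ U]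

/-- The operator `∑ a, (∏ j, c j (a j)) • π a` by which a family `c` of functions on `D` acts on
a representation of a power of `D`, as a multilinear function of `c`. -/
def powAct (π : Representation ℂ (κ → D) U) :
    MultilinearMap ℂ (fun _ : κ => D → ℂ) (U →ₗ[ℂ] U) :=
  ∑ a : κ → D, ((MultilinearMap.mkPiAlgebra ℂ κ ℂ).compLinearMap
    fun j => LinearMap.proj (a j)).smulRight (π a)

theorem powAct_apply (π : Representation ℂ (κ → D) U) (c : κ → D → ℂ) (u : U) :
    powAct π c u = ∑ a : κ → D, (∏ j, c j (a j)) • π a u := by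
  simp [powAct, LinearMap.sum_apply]

/-- The delta functions at the identity act trivially. -/
theorem powAct_delta (π : Representation ℂ (κ → D) U) [DecidableEq D] (u : U) :
    powAct π (fun _ => Pi.single 1 1) u = u := by
  rw [powAct_apply, Finset.sum_eq_single 1]
  · simp
  · intro a _ ha
    obtain ⟨j, hj⟩ := Function.ne_iff.1 ha
    rw [Finset.prod_eq_zero (Finset.mem_univ j), zero_smul]
    exact Pi.single_eq_of_ne hj 1
  · simp

theorem powAct_comm {U' : Type*} [AddCommGroup U'] [Module ℂ U']
    {π : Representation ℂ (κ → D) U} {π' : Representation ℂ (κ → D) U'} (f : U →ₗ[ℂ] U')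
    (hf : ∀ a u, f (π a u) = π' a (f u)) (c : κ → D → ℂ) (u : U) :
    f (powAct π c u) = powAct π' c (f u) := by
  simp [powAct_apply, hf]

theorem powAct_mem (π : Representation ℂ (κ → D) U) {S : Submodule ℂ U}
    (hS : ∀ a, ∀ u ∈ S, π a u ∈ S) (c : κ → D → ℂ) {u : U} (hu : u ∈ S) : powAct π c u ∈ S := by
  rw [powAct_apply]
  exact S.sum_mem fun a _ => S.smul_mem _ (hS a u hu)

variable {ι : Type} {V : ι → Type u} [∀ i, AddCommGroup (V i)] [∀ i, Module ℂ (V i)]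

/-- The family of matrix coefficients attached to a word `x`, functionals `φ j` and vectors
`w j`. -/
def wordCoeff (ρ : ∀ i, Representation ℂ D (V i)) (x : κ → ι) (φ : ∀ j, Module.Dual ℂ (V (x j)))
    (w : ∀ j, V (x j)) : κ → D → ℂ :=
  fun j => matCoeff (ρ (x j)) (φ j) (w j)

/-- Every nonzero vector is detected by the coefficients of some word, because the delta function
at the identity is a combination of matrix coefficients. -/
theorem exists_wordCoeff_ne_zero {ρ : ∀ i, Representation ℂ D (V i)} (hρ : IsTraversal ρ)
    (π : Representation ℂ (κ → D) U) {u : U} (hu : u ≠ 0) :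
    ∃ (x : κ → ι) (φ : ∀ j, Module.Dual ℂ (V (x j))) (w : ∀ j, V (x j)),
      powAct π (wordCoeff ρ x φ w) u ≠ 0 := by
  classical
  by_contra! h
  have h0 : (LinearMap.applyₗ u).compMultilinearMap (powAct π) = 0 := by
    refine multilinear_eq_zero_of_span _ (span_matCoeff hρ) fun c hc => ?_
    choose x φ w hc using hc
    obtain rfl : wordCoeff ρ x φ w = c := funext hc
    exact h x φ w
  refine hu ?_
  rw [← powAct_delta π u]
  exact DFunLike.congr_fun h0 fun _ => Pi.single 1 1

/-- The vector `powAct π (wordCoeff ρ x φ w) u` depends equivariantly on `w`. -/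
theorem powAct_wordCoeff_map (ρ : ∀ i, Representation ℂ D (V i)) (π : Representation ℂ (κ → D) U)
    (x : κ → ι) (φ : ∀ j, Module.Dual ℂ (V (x j))) (w : ∀ j, V (x j)) (b : κ → D) (u : U) :
    powAct π (wordCoeff ρ x φ fun j => ρ (x j) (b j) (w j)) u =
      π b (powAct π (wordCoeff ρ x φ w) u) := by
  simp only [powAct_apply, map_sum, map_smul]
  refine Fintype.sum_equiv (Equiv.mulLeft b⁻¹) _ _ fun a => ?_
  simp [wordCoeff, matCoeff_map, ← Module.End.mul_apply, ← map_mul]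

end Power

/-! ### Induced representations -/

section Ind

variable {G H A B : Type*} [Group G] [Group H] [AddCommGroup A] [Module ℂ A] [AddCommGroup B]
  [Module ℂ B] (φ : G →* H) (ρ : Representation ℂ G A)

/-- The relation defining the induced representation: `φ g * h ⊗ g a = h ⊗ a`. -/
theorem indV_mk_mul (g : G) (h : H) (a : A) :
    Representation.IndV.mk φ ρ (φ g * h) (ρ g a) = Representation.IndV.mk φ ρ h a := by
  have := Representation.Coinvariants.mk_self_apply
    (Representation.tprod ((Representation.leftRegular ℂ H).comp φ) ρ) g
    (MonoidAlgebra.single h (1 : ℂ) ⊗ₜ[ℂ] a)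
  simpa using this

/-- The linear map out of an induced representation given by a compatible family of maps. -/
def indVLift (F : H → A →ₗ[ℂ] B) (hF : ∀ g h a, F (φ g * h) (ρ g a) = F h a) :
    Representation.IndV φ ρ →ₗ[ℂ] B :=
  Representation.Coinvariants.lift _
    (TensorProduct.lift <| (Finsupp.lift _ _ _ F) ∘ₗ
      (MonoidAlgebra.coeffLinearEquiv ℂ).toLinearMap)
    fun g => by
      ext h a
      simp [hF]

theorem indVLift_mk (F : H → A →ₗ[ℂ] B) (hF : ∀ g h a, F (φ g * h) (ρ g a) = F h a) (h : H)
    (a : A) : indVLift φ ρ F hF (Representation.IndV.mk φ ρ h a) = F h a := by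
  simp [indVLift]

/-- Frobenius reciprocity: an equivariant map on `A` extends to the induced representation. -/
theorem exists_intertwiningMap_ind (σ : Representation ℂ H B) (f : A →ₗ[ℂ] B)
    (hf : ∀ g a, f (ρ g a) = σ (φ g) (f a)) :
    ∃ F : Representation.IntertwiningMap (Representation.ind φ ρ) σ,
      ∀ a, F (Representation.IndV.mk φ ρ 1 a) = f a := by
  let F := indVLift φ ρ (fun h => σ h⁻¹ ∘ₗ f) fun g h a => by
    simp [hf, ← Module.End.mul_apply, ← map_mul]
  have hF : ∀ h a, F (Representation.IndV.mk φ ρ h a) = σ h⁻¹ (f a) := indVLift_mk φ ρ _ _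
  refine ⟨⟨F, fun g => ?_⟩, fun a => ?_⟩
  · refine Representation.IndV.hom_ext φ ρ fun h => LinearMap.ext fun a => ?_
    change F (Representation.ind φ ρ g (Representation.IndV.mk φ ρ h a)) =
      σ g (F (Representation.IndV.mk φ ρ h a))
    rw [Representation.ind_mk, hF, hF, ← Module.End.mul_apply, ← map_mul]
    simp
  · exact (hF 1 a).trans (by simp)

/-- For induction from a subgroup, the summand of the identity coset is a faithful copy of the
inducing representation: projection to that summand is a left inverse. -/
theorem indV_mk_one_injective (S : Subgroup H) (ρ : Representation ℂ S A) :
    Function.Injective (Representation.IndV.mk S.subtype ρ 1) := by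
  classical
  let F := indVLift S.subtype ρ (fun h => if hh : h ∈ S then ρ ⟨h, hh⟩⁻¹ else 0) fun g h a => by
    by_cases hh : h ∈ S
    · rw [dif_pos hh, dif_pos (show S.subtype g * h ∈ S from S.mul_mem g.2 hh),
        ← Module.End.mul_apply, ← map_mul]
      congr 2
      ext
      simp
    · rw [dif_neg hh, dif_neg (show S.subtype g * h ∉ S from
        fun h' => hh ((S.mul_mem_cancel_left g.2).1 h'))]
      simp
  refine Function.LeftInverse.injective (g := F) fun a => ?_
  rw [indVLift_mk, dif_pos S.one_mem]
  change ρ (1 : S)⁻¹ a = a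
  simp

/-- The induced representation is spanned by the classes `h ⊗ a` with `a` in a spanning set and `h`
in a set meeting every coset. -/
theorem span_indV_mk {s : Set A} (hs : Submodule.span ℂ s = ⊤) {t : Set H}
    (ht : ∀ h, ∃ g, φ g * h ∈ t) :
    Submodule.span ℂ {z | ∃ h ∈ t, ∃ a ∈ s, Representation.IndV.mk φ ρ h a = z} = ⊤ := by
  set P := Submodule.span ℂ {z | ∃ h ∈ t, ∃ a ∈ s, Representation.IndV.mk φ ρ h a = z}
  have h1 : ∀ h ∈ t, ∀ a, Representation.IndV.mk φ ρ h a ∈ P := by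
    intro h hh a
    have hle : Submodule.span ℂ s ≤ P.comap (Representation.IndV.mk φ ρ h) :=
      Submodule.span_le.2 fun a ha => Submodule.subset_span ⟨h, hh, a, ha, rfl⟩
    exact hle (hs ▸ trivial)
  have h2 : ∀ h a, Representation.IndV.mk φ ρ h a ∈ P := by
    intro h a
    obtain ⟨g, hg⟩ := ht h
    rw [← indV_mk_mul φ ρ g]
    exact h1 _ hg _
  have h3 : P.mkQ = 0 := Representation.IndV.hom_ext φ ρ fun h => LinearMap.ext fun a =>
    (Submodule.Quotient.mk_eq_zero P).2 (h2 h a)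
  rw [← Submodule.ker_mkQ P, h3, LinearMap.ker_zero]

end Ind

/-! ### Matrix coefficients acting on the induced representations -/

section Wreath

open Representation (IndV)

variable {D : Type} [Group D] {ι : Type} {n : ℕ}
  {V : ι → Type u} [∀ i, AddCommGroup (V i)] [∀ i, Module ℂ (V i)]

/-- The inclusion of the base group `D^n` into `D ≀ ℤ/n`. -/
def baseIncl (D : Type) [Group D] (n : ℕ) : (Cyc n → D) →* D ≀ᵣ Cyc n where
  toFun a := ⟨a, 1⟩
  map_one' := rfl
  map_mul' a b := by ext <;> simp

/-- The inclusion of the base group `D^n` into `D^n ⋊ S_x`. -/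
def baseInclInertia (D : Type) [Group D] (x : Cyc n → ι) : (Cyc n → D) →* inertia D x :=
  (baseIncl D n).codRestrict (inertia D x) fun _ => (stab x).one_mem

theorem span_range_tprod {κ : Type} (M : κ → Type u) [∀ j, AddCommGroup (M j)]
    [∀ j, Module ℂ (M j)] :
    Submodule.span ℂ (Set.range (PiTensorProduct.tprod ℂ (s := M))) = ⊤ :=
  PiTensorProduct.span_tprod_eq_top

variable [NeZero n]

/-- The base group acts factorwise; the character plays no role. -/
theorem twistedRep_base_tprod (ρ : ∀ i, Representation ℂ D (V i)) (x : Cyc n → ι)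
    (τ : stab x →* ℂˣ) (a : Cyc n → D) (v : ∀ j, V (x j)) :
    twistedRep ρ x τ (baseInclInertia D x a) (PiTensorProduct.tprod ℂ v) =
      PiTensorProduct.tprod ℂ fun j => ρ (x j) (a j) (v j) := by
  have h1 : inertiaProj D x (baseInclInertia D x a) = 1 := rfl
  change (τ (inertiaProj D x (baseInclInertia D x a)) : ℂ) •
    tensorOp ρ x (baseInclInertia D x a) (PiTensorProduct.tprod ℂ v) = _
  rw [h1, map_one, Units.val_one, one_smul, tensorOp_tprod]
  refine congrArg _ (funext fun j => ?_)
  exact congrArg (ρ (x j) (a j)) (cast_self x v (show (1 : Cyc n)⁻¹ * j = j by simp) _)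

variable [Fintype D]

theorem powAct_twistedRep_tprod (ρ : ∀ i, Representation ℂ D (V i)) (x : Cyc n → ι)
    (τ : stab x →* ℂˣ) (c : Cyc n → D → ℂ) (v : ∀ j, V (x j)) :
    powAct ((twistedRep ρ x τ).comp (baseInclInertia D x)) c (PiTensorProduct.tprod ℂ v) =
      PiTensorProduct.tprod ℂ fun j => funAct (ρ (x j)) (c j) (v j) := by
  simp only [funAct_apply, powAct_apply, MonoidHom.comp_apply, twistedRep_base_tprod]
  rw [MultilinearMap.map_sum]
  simp only [MultilinearMap.map_smul_univ]

/-- On the summand of the rotation `q`, a family of functions acts through its rotation by `q`. -/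
theorem powAct_inducedRep_mk (ρ : ∀ i, Representation ℂ D (V i)) (x : Cyc n → ι)
    (τ : stab x →* ℂˣ) (c : Cyc n → D → ℂ) (q : Cyc n) (t : ⨂[ℂ] j, V (x j)) :
    powAct ((inducedRep ρ x τ).comp (baseIncl D n)) c
        (IndV.mk (inertia D x).subtype (twistedRep ρ x τ) (RegularWreathProduct.inl q) t) =
      IndV.mk (inertia D x).subtype (twistedRep ρ x τ) (RegularWreathProduct.inl q)
        (powAct ((twistedRep ρ x τ).comp (baseInclInertia D x)) (fun j => c (q⁻¹ * j)) t) := by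
  simp only [powAct_apply, map_sum, map_smul, MonoidHom.comp_apply]
  refine Fintype.sum_equiv (Equiv.arrowCongr (Equiv.mulLeft q) (Equiv.refl D)) _ _ fun a => ?_
  have hprod : ∏ j, c (q⁻¹ * j) (a (q⁻¹ * j)) = ∏ j, c j (a j) :=
    Fintype.prod_equiv (Equiv.mulLeft q⁻¹) _ _ fun j => rfl
  have hconj : RegularWreathProduct.inl q * (baseIncl D n a)⁻¹ =
      (inertia D x).subtype (baseInclInertia D x fun j => a (q⁻¹ * j))⁻¹ *
        RegularWreathProduct.inl q := by
    rw [map_inv, eq_inv_mul_iff_mul_eq, ← mul_assoc, mul_inv_eq_iff_eq_mul]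
    ext <;> simp [baseIncl, baseInclInertia]
  have hmk : inducedRep ρ x τ (baseIncl D n a)
      (IndV.mk (inertia D x).subtype (twistedRep ρ x τ) (RegularWreathProduct.inl q) t) =
      IndV.mk (inertia D x).subtype (twistedRep ρ x τ) (RegularWreathProduct.inl q)
        (twistedRep ρ x τ (baseInclInertia D x fun j => a (q⁻¹ * j)) t) := by
    rw [inducedRep, Representation.ind_mk, hconj, ← indV_mk_mul _ _
      (baseInclInertia D x fun j => a (q⁻¹ * j))⁻¹ (RegularWreathProduct.inl q),
      ← Module.End.mul_apply (twistedRep ρ x τ _), ← map_mul, inv_mul_cancel, map_one,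
      Module.End.one_apply]
  rw [hmk, ← hprod]
  rfl

omit [Fintype D] in
/-- A subspace of the induced representation containing the pure tensors in all translates by
rotations is everything. -/
theorem inducedRep_ext_span (ρ : ∀ i, Representation ℂ D (V i)) (x : Cyc n → ι)
    (τ : stab x →* ℂˣ) {P : Submodule ℂ (IndV (inertia D x).subtype (twistedRep ρ x τ))}
    (hP : ∀ q v, IndV.mk (inertia D x).subtype (twistedRep ρ x τ) (RegularWreathProduct.inl q)
      (PiTensorProduct.tprod ℂ v) ∈ P) : P = ⊤ := by
  rw [eq_top_iff, ← span_indV_mk (inertia D x).subtype (twistedRep ρ x τ)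
    (span_range_tprod _) (t := Set.range (RegularWreathProduct.inl (D := D) (Q := Cyc n)))
    fun g => ⟨(baseInclInertia D x g.left)⁻¹, g.right, ?_⟩, Submodule.span_le]
  · rintro _ ⟨_, ⟨q, rfl⟩, _, ⟨v, rfl⟩, rfl⟩
    exact hP q v
  · rw [map_inv, eq_inv_mul_iff_mul_eq]
    ext <;> simp [baseIncl, baseInclInertia]

theorem powAct_wordCoeff_mk {ρ : ∀ i, Representation ℂ D (V i)} (hρ : IsTraversal ρ)
    (x y : Cyc n → ι) (τ : stab y →* ℂˣ) (φ : ∀ j, Module.Dual ℂ (V (x j))) (w : ∀ j, V (x j))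
    (q : Cyc n) (hq : rotate q⁻¹ x ≠ y) (v : ∀ j, V (y j)) :
    powAct ((inducedRep ρ y τ).comp (baseIncl D n)) (wordCoeff ρ x φ w)
      (IndV.mk (inertia D y).subtype (twistedRep ρ y τ) (RegularWreathProduct.inl q)
        (PiTensorProduct.tprod ℂ v)) = 0 := by
  obtain ⟨j, hj⟩ := Function.ne_iff.1 hq
  rw [powAct_inducedRep_mk, powAct_twistedRep_tprod, MultilinearMap.map_coord_zero _ j, map_zero]
  refine funAct_matCoeff_of_not_equiv _ _ (hρ.1 _) (hρ.1 _) (fun h => hj ?_) _ _ _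
  rw [← hρ.2.1 _ _ h, rotate, mul_comm]

/-- The operators of a word `x` vanish on the representations induced from words outside the orbit
of `x`. -/
theorem powAct_wordCoeff_of_notMem_orbit {ρ : ∀ i, Representation ℂ D (V i)}
    (hρ : IsTraversal ρ) {x y : Cyc n → ι} (hxy : y ∉ orbit x) (τ : stab y →* ℂˣ)
    (φ : ∀ j, Module.Dual ℂ (V (x j))) (w : ∀ j, V (x j)) :
    powAct ((inducedRep ρ y τ).comp (baseIncl D n)) (wordCoeff ρ x φ w) = 0 := by
  rw [← LinearMap.ker_eq_top]
  exact inducedRep_ext_span ρ y τ fun q v =>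
    powAct_wordCoeff_mk hρ x y τ φ w q (fun h => hxy ⟨q⁻¹, h⟩) v

/-- On the summand of the identity coset the operators of the word `x` are of rank one. -/
theorem powAct_wordCoeff_mk_one {ρ : ∀ i, Representation ℂ D (V i)} (hρ : IsTraversal ρ)
    (x : Cyc n → ι) (τ : stab x →* ℂˣ) (φ : ∀ j, Module.Dual ℂ (V (x j))) (w v : ∀ j, V (x j)) :
    powAct ((inducedRep ρ x τ).comp (baseIncl D n)) (wordCoeff ρ x φ w)
      (IndV.mk (inertia D x).subtype (twistedRep ρ x τ) 1 (PiTensorProduct.tprod ℂ v)) =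
      (∏ j, φ j (v j)) • IndV.mk (inertia D x).subtype (twistedRep ρ x τ) 1
        (PiTensorProduct.tprod ℂ w) := by
  have := powAct_inducedRep_mk ρ x τ (wordCoeff ρ x φ w) 1 (PiTensorProduct.tprod ℂ v)
  rw [map_one] at this
  rw [this]
  simp only [inv_one, one_mul]
  rw [powAct_twistedRep_tprod]
  simp only [wordCoeff, funAct_matCoeff_self _ (hρ.1 _)]
  rw [MultilinearMap.map_smul_univ, map_smul]

/-- The operators of the word `x` annihilate all summands except that of the identity coset. -/
theorem powAct_wordCoeff_mem_span {ρ : ∀ i, Representation ℂ D (V i)} (hρ : IsTraversal ρ)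
    (x : Cyc n → ι) (τ : stab x →* ℂˣ) (φ : ∀ j, Module.Dual ℂ (V (x j))) (w : ∀ j, V (x j))
    (z : IndV (inertia D x).subtype (twistedRep ρ x τ)) :
    powAct ((inducedRep ρ x τ).comp (baseIncl D n)) (wordCoeff ρ x φ w) z ∈
      Submodule.span ℂ {IndV.mk (inertia D x).subtype (twistedRep ρ x τ) 1
        (PiTensorProduct.tprod ℂ w)} := by
  set L := Submodule.span ℂ {IndV.mk (inertia D x).subtype (twistedRep ρ x τ) 1
        (PiTensorProduct.tprod ℂ w)}
  set p := powAct ((inducedRep ρ x τ).comp (baseIncl D n)) (wordCoeff ρ x φ w)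
  have h1 : ∀ t, p (IndV.mk (inertia D x).subtype (twistedRep ρ x τ) 1 t) ∈ L := by
    intro t
    have hle : Submodule.span ℂ (Set.range (PiTensorProduct.tprod ℂ (s := fun j => V (x j)))) ≤
        L.comap (p ∘ₗ IndV.mk (inertia D x).subtype (twistedRep ρ x τ) 1) := by
      rw [Submodule.span_le]
      rintro _ ⟨v, rfl⟩
      exact Submodule.mem_span_singleton.2 ⟨_, (powAct_wordCoeff_mk_one hρ x τ φ w v).symm⟩
    exact hle (span_range_tprod (fun j => V (x j)) ▸ trivial)
  have htop : L.comap p = ⊤ := inducedRep_ext_span ρ x τ fun q v => by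
    rw [Submodule.mem_comap]
    by_cases hq : q ∈ stab x
    -- A rotation fixing `x` belongs to the identity coset.
    · let g : inertia D x := ⟨RegularWreathProduct.inl q, hq⟩
      rw [← indV_mk_mul _ _ g⁻¹,
        show (inertia D x).subtype g⁻¹ * RegularWreathProduct.inl q = 1 from inv_mul_cancel _]
      exact h1 _
    · rw [powAct_wordCoeff_mk hρ x x τ φ w q
        (fun h => hq ((stab x).inv_mem_iff.1 ((mem_stab_iff x _).2 h)))]
      exact L.zero_mem
  exact (htop ▸ trivial : z ∈ L.comap p)

end Wreath

/-! ### Irreducibility, distinctness and exhaustion -/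

section Traversal

open Representation (IndV)

variable {D : Type} [Group D] {ι : Type} {n : ℕ}
  {V : ι → Type u} [∀ i, AddCommGroup (V i)] [∀ i, Module ℂ (V i)]

theorem exists_dual_eq_one {E : Type*} [AddCommGroup E] [Module ℂ E] {v : E} (hv : v ≠ 0) :
    ∃ φ : Module.Dual ℂ E, φ v = 1 := by
  obtain ⟨φ, hφ⟩ : ∃ φ : Module.Dual ℂ E, φ v ≠ 0 := by
    by_contra! h
    exact hv ((Module.forall_dual_apply_eq_zero_iff ℂ v).1 h)
  exact ⟨(φ v)⁻¹ • φ, inv_mul_cancel₀ hφ⟩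

theorem tprod_ne_zero {κ : Type} [Fintype κ] {M : κ → Type u} [∀ j, AddCommGroup (M j)]
    [∀ j, Module ℂ (M j)] {v : ∀ j, M j} {φ : ∀ j, Module.Dual ℂ (M j)} (h : ∀ j, φ j (v j) = 1) :
    PiTensorProduct.tprod ℂ v ≠ 0 := fun h0 => by
  have := congrArg (PiTensorProduct.lift ((MultilinearMap.mkPiAlgebra ℂ κ ℂ).compLinearMap φ)) h0
  simp [h] at this

theorem self_mem_orbit (x : Cyc n → ι) : x ∈ orbit x := ⟨1, rotate_one x⟩

theorem eq_of_mem_orbit {J : Set (Cyc n → ι)} (hJ : IsOrbitReps J) {x y : Cyc n → ι} (hx : x ∈ J)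
    (hy : y ∈ J) (h : y ∈ orbit x) : x = y :=
  hJ.2.elim_set hx hy y h (self_mem_orbit y)

variable [NeZero n] [Fintype D]

/-- Conjugation by a rotation rotates the family of functions. -/
theorem map_powAct_inl {U : Type*} [AddCommGroup U] [Module ℂ U]
    (σ : Representation ℂ (D ≀ᵣ Cyc n) U) (q : Cyc n) (c : Cyc n → D → ℂ) (u : U) :
    σ (RegularWreathProduct.inl q) (powAct (σ.comp (baseIncl D n)) c u) =
      powAct (σ.comp (baseIncl D n)) (fun j => c (q⁻¹ * j))
        (σ (RegularWreathProduct.inl q) u) := by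
  simp only [powAct_apply, map_sum, map_smul, MonoidHom.comp_apply]
  refine Fintype.sum_equiv (Equiv.arrowCongr (Equiv.mulLeft q) (Equiv.refl D)) _ _ fun a => ?_
  have hprod : ∏ j, c (q⁻¹ * j) (a (q⁻¹ * j)) = ∏ j, c j (a j) :=
    Fintype.prod_equiv (Equiv.mulLeft q⁻¹) _ _ fun j => rfl
  have hconj : RegularWreathProduct.inl q * baseIncl D n a =
      baseIncl D n (fun j => a (q⁻¹ * j)) * RegularWreathProduct.inl q := by
    ext <;> simp [baseIncl]
  rw [← hprod, ← Module.End.mul_apply (σ _), ← map_mul, hconj, map_mul, Module.End.mul_apply]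
  rfl

/-- After a translation, every nonzero vector is detected by the coefficients of a word in `J`. -/
theorem exists_mem_wordCoeff_ne_zero {ρ : ∀ i, Representation ℂ D (V i)} (hρ : IsTraversal ρ)
    {J : Set (Cyc n → ι)} (hJ : IsOrbitReps J) {U : Type*} [AddCommGroup U] [Module ℂ U]
    (σ : Representation ℂ (D ≀ᵣ Cyc n) U) {u : U} (hu : u ≠ 0) :
    ∃ x ∈ J, ∃ (φ : ∀ j, Module.Dual ℂ (V (x j))) (w : ∀ j, V (x j)) (g : D ≀ᵣ Cyc n),
      powAct (σ.comp (baseIncl D n)) (wordCoeff ρ x φ w) (σ g u) ≠ 0 := by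
  obtain ⟨y, φ, w, h⟩ := exists_wordCoeff_ne_zero hρ (σ.comp (baseIncl D n)) hu
  obtain ⟨x, hx, q, rfl⟩ := Set.mem_iUnion₂.1 (hJ.1 ▸ Set.mem_univ y)
  -- Rotating the coefficients of `rotate q x` back gives coefficients of `x`, up to transport
  -- along equalities of letters.
  have htr : ∀ j, ∃ (φ' : Module.Dual ℂ (V (x j))) (w' : V (x j)),
      matCoeff (ρ (x j)) φ' w' = wordCoeff ρ (rotate q x) φ w (q⁻¹ * j) := by
    have hcast : ∀ i i' (φ : Module.Dual ℂ (V i)) (w : V i), i = i' →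
        ∃ (φ' : Module.Dual ℂ (V i')) (w' : V i'), matCoeff (ρ i') φ' w' = matCoeff (ρ i) φ w := by
      rintro i _ φ w rfl
      exact ⟨φ, w, rfl⟩
    exact fun j => hcast _ _ _ _ (by simp [rotate])
  choose φ' w' hc using htr
  refine ⟨x, hx, φ', w', RegularWreathProduct.inl q, fun h0 => h ?_⟩
  have hw : wordCoeff ρ x φ' w' = fun j => wordCoeff ρ (rotate q x) φ w (q⁻¹ * j) := funext hc
  rw [hw, ← map_powAct_inl] at h0
  exact (Module.End.isUnit_iff _).1 ((Group.isUnit (RegularWreathProduct.inl q)).map σ)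
    |>.1 (h0.trans (map_zero _).symm)

omit [Fintype D] in
/-- The summand of the identity coset generates the induced representation. -/
theorem subrepresentation_eq_top {ρ : ∀ i, Representation ℂ D (V i)} {x : Cyc n → ι}
    {τ : stab x →* ℂˣ} {S : Subrepresentation (inducedRep ρ x τ)}
    (hS : ∀ v, IndV.mk (inertia D x).subtype (twistedRep ρ x τ) 1 (PiTensorProduct.tprod ℂ v) ∈ S) :
    S = ⊤ := by
  have : S.toSubmodule = ⊤ := inducedRep_ext_span ρ x τ fun q v => by
    have := S.apply_mem_toSubmodule (RegularWreathProduct.inl q)⁻¹ (hS v)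
    change Representation.ind _ _ _ _ ∈ _ at this
    rwa [Representation.ind_mk, inv_inv, one_mul] at this
  exact Subrepresentation.toSubmodule_injective this

theorem isIrreducible_inducedRep {ρ : ∀ i, Representation ℂ D (V i)} (hρ : IsTraversal ρ)
    {J : Set (Cyc n → ι)} (hJ : IsOrbitReps J) {x : Cyc n → ι} (hx : x ∈ J) (τ : stab x →* ℂˣ) :
    (inducedRep ρ x τ).IsIrreducible := by
  have hnt : Nontrivial (Subrepresentation (inducedRep ρ x τ)) := by
    choose v hv using fun j => exists_ne_zero_of_isIrreducible _ (hρ.1 (x j))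
    choose φ hφ using fun j => exists_dual_eq_one (hv j)
    refine ⟨⊥, ⊤, fun h => tprod_ne_zero hφ (indV_mk_one_injective _ (twistedRep ρ x τ) ?_)⟩
    have : IndV.mk (inertia D x).subtype (twistedRep ρ x τ) 1 (PiTensorProduct.tprod ℂ v) ∈
        (⊤ : Subrepresentation (inducedRep ρ x τ)) := trivial
    rw [← h] at this
    rw [map_zero]
    exact this
  refine { eq_bot_or_eq_top := fun S => or_iff_not_imp_left.2 fun hS => ?_ }
  obtain ⟨u, huS, hu⟩ : ∃ u ∈ S, u ≠ 0 := by
    by_contra! h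
    exact hS (le_bot_iff.1 fun a ha => h a ha)
  obtain ⟨y, hy, φ, w, g, h⟩ := exists_mem_wordCoeff_ne_zero hρ hJ (inducedRep ρ x τ) hu
  obtain rfl : y = x := by
    refine eq_of_mem_orbit hJ hy hx (by_contra fun hxy => h ?_)
    rw [powAct_wordCoeff_of_notMem_orbit hρ hxy, LinearMap.zero_apply]
  have hpS : ∀ c, ∀ z ∈ S, powAct ((inducedRep ρ y τ).comp (baseIncl D n)) c z ∈ S :=
    fun c z hz => powAct_mem (S := S.toSubmodule) _
      (fun a _ hu => S.apply_mem_toSubmodule (baseIncl D n a) hu) c hz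
  obtain ⟨c, hc⟩ := Submodule.mem_span_singleton.1 (powAct_wordCoeff_mem_span hρ y τ φ w
    (inducedRep ρ y τ g u))
  have hcS := hpS (wordCoeff ρ y φ w) _ (S.apply_mem_toSubmodule g huS)
  rw [← hc] at h hcS
  have hc0 : c ≠ 0 := fun h0 => h (by rw [h0, zero_smul])
  have hwS : IndV.mk (inertia D y).subtype (twistedRep ρ y τ) 1 (PiTensorProduct.tprod ℂ w) ∈ S :=
    (S.toSubmodule.smul_mem_iff hc0).1 hcS
  have hw : ∀ j, w j ≠ 0 := fun j hj => h (by
    rw [MultilinearMap.map_coord_zero _ j hj, map_zero, smul_zero])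
  choose ψ hψ using fun j => exists_dual_eq_one (hw j)
  refine subrepresentation_eq_top fun v => ?_
  have := hpS (wordCoeff ρ y ψ v) _ hwS
  rwa [powAct_wordCoeff_mk_one hρ, Finset.prod_congr rfl fun j _ => hψ j, Finset.prod_const_one,
    one_smul] at this

theorem equiv_map_powAct {U U' : Type*} [AddCommGroup U] [Module ℂ U]
    [AddCommGroup U'] [Module ℂ U'] {σ : Representation ℂ (D ≀ᵣ Cyc n) U}
    {σ' : Representation ℂ (D ≀ᵣ Cyc n) U'} (E : σ.Equiv σ') (c : Cyc n → D → ℂ) (u : U) :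
    E (powAct (σ.comp (baseIncl D n)) c u) = powAct (σ'.comp (baseIncl D n)) c (E u) :=
  powAct_comm E.toLinearMap (fun a u =>
    Representation.IntertwiningMap.isIntertwining _ _ E.toIntertwiningMap (baseIncl D n a) u) c u

omit [NeZero n] [Fintype D] in
theorem ind_mk_one {G H A : Type*} [Group G] [Group H] [AddCommGroup A] [Module ℂ A] (φ : G →* H)
    (ρ : Representation ℂ G A) (g : G) (a : A) :
    Representation.ind φ ρ (φ g) (IndV.mk φ ρ 1 a) = IndV.mk φ ρ 1 (ρ g a) := by
  rw [Representation.ind_mk, one_mul, ← map_inv, ← indV_mk_mul φ ρ g, ← map_mul, mul_inv_cancel,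
    map_one]

/-- Distinct characters give non-isomorphic induced representations, since an isomorphism is a
scalar on the summand of the identity coset. -/
theorem eq_of_equiv_inducedRep {ρ : ∀ i, Representation ℂ D (V i)} (hρ : IsTraversal ρ)
    {x : Cyc n → ι} {τ τ' : stab x →* ℂˣ}
    (E : (inducedRep ρ x τ).Equiv (inducedRep ρ x τ')) : τ = τ' := by
  choose w hw using fun j => exists_ne_zero_of_isIrreducible _ (hρ.1 (x j))
  choose φ hφ using fun j => exists_dual_eq_one (hw j)
  have hv : ∀ v, E (IndV.mk _ (twistedRep ρ x τ) 1 (PiTensorProduct.tprod ℂ v)) =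
      powAct ((inducedRep ρ x τ').comp (baseIncl D n)) (wordCoeff ρ x φ v)
        (E (IndV.mk _ (twistedRep ρ x τ) 1 (PiTensorProduct.tprod ℂ w))) := fun v => by
    rw [← equiv_map_powAct, powAct_wordCoeff_mk_one hρ,
      Finset.prod_congr rfl fun j _ => hφ j, Finset.prod_const_one, one_smul]
  -- The pure tensor `w` is fixed by its own operator, so its image under `E` is a multiple of the
  -- corresponding pure tensor; the operators of the other vectors `v` carry this over to them.
  obtain ⟨c, hc⟩ := Submodule.mem_span_singleton.1 (powAct_wordCoeff_mem_span hρ x τ' φ w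
    (E (IndV.mk _ (twistedRep ρ x τ) 1 (PiTensorProduct.tprod ℂ w))))
  rw [← hv] at hc
  have hlin : E.toLinearMap ∘ₗ IndV.mk _ (twistedRep ρ x τ) 1 =
      c • IndV.mk _ (twistedRep ρ x τ') 1 := PiTensorProduct.ext (MultilinearMap.ext fun v => by
    refine (hv v).trans ?_
    rw [← hc, map_smul, powAct_wordCoeff_mk_one hρ, Finset.prod_congr rfl fun j _ => hφ j,
      Finset.prod_const_one, one_smul]
    rfl)
  have hE : ∀ t, E (IndV.mk _ (twistedRep ρ x τ) 1 t) = c • IndV.mk _ (twistedRep ρ x τ') 1 t :=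
    fun t => LinearMap.congr_fun hlin t
  have ht := tprod_ne_zero hφ
  have hc0 : c ≠ 0 := by
    rintro rfl
    refine ht (indV_mk_one_injective _ (twistedRep ρ x τ) (E.toLinearEquiv.injective ?_))
    rw [map_zero, map_zero]
    exact (hE _).trans (zero_smul _ _)
  refine MonoidHom.ext fun s => Units.ext ?_
  let g : inertia D x := ⟨RegularWreathProduct.inl s.1, s.2⟩
  set t := PiTensorProduct.tprod ℂ w
  have h1 : twistedRep ρ x τ g t = twistedRep ρ x τ' g t := by
    refine indV_mk_one_injective _ (twistedRep ρ x τ') (smul_right_injective _ hc0 ?_)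
    change c • _ = c • _
    rw [← hE, ← ind_mk_one, ← ind_mk_one, ← map_smul, ← hE]
    exact Representation.IntertwiningMap.isIntertwining _ _ E.toIntertwiningMap _ _
  have h2 : tensorRep ρ x g t ≠ 0 := fun h0 => ht
    (((Module.End.isUnit_iff _).1 ((Group.isUnit g).map (tensorRep ρ x))).1
      (h0.trans (map_zero _).symm))
  exact smul_left_injective ℂ h2 h1

/-- Representations induced from different words of `J` are separated by the operators of one of
the words. -/
theorem eq_of_equiv_inducedRep_of_mem {ρ : ∀ i, Representation ℂ D (V i)} (hρ : IsTraversal ρ)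
    {J : Set (Cyc n → ι)} (hJ : IsOrbitReps J) {x y : Cyc n → ι} (hx : x ∈ J) (hy : y ∈ J)
    {τ : stab x →* ℂˣ} {τ' : stab y →* ℂˣ}
    (E : (inducedRep ρ x τ).Equiv (inducedRep ρ y τ')) : x = y := by
  choose w hw using fun j => exists_ne_zero_of_isIrreducible _ (hρ.1 (x j))
  choose φ hφ using fun j => exists_dual_eq_one (hw j)
  refine eq_of_mem_orbit hJ hx hy (by_contra fun hxy => tprod_ne_zero hφ ?_)
  refine indV_mk_one_injective _ (twistedRep ρ x τ) (E.toLinearEquiv.injective ?_)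
  have h := equiv_map_powAct E (wordCoeff ρ x φ w)
    (IndV.mk _ (twistedRep ρ x τ) 1 (PiTensorProduct.tprod ℂ w))
  rw [powAct_wordCoeff_mk_one hρ, Finset.prod_congr rfl fun j _ => hφ j, Finset.prod_const_one,
      one_smul, powAct_wordCoeff_of_notMem_orbit hρ hxy] at h
  rw [map_zero, map_zero]
  exact h

/-- A nonzero representation admits a nonzero `D^n`-equivariant map from `⨂ j, V (x j)` for some
`x ∈ J`, namely `w ↦ powAct _ (wordCoeff ρ x φ w) u` for suitable `φ` and `u`. -/
theorem exists_base_equivariant {ρ : ∀ i, Representation ℂ D (V i)} (hρ : IsTraversal ρ)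
    {J : Set (Cyc n → ι)} (hJ : IsOrbitReps J) {U : Type*} [AddCommGroup U] [Module ℂ U]
    (σ : Representation ℂ (D ≀ᵣ Cyc n) U) {u : U} (hu : u ≠ 0) :
    ∃ x ∈ J, ∃ F : (⨂[ℂ] j, V (x j)) →ₗ[ℂ] U, F ≠ 0 ∧
      ∀ b t, F (tensorRep ρ x (baseInclInertia D x b) t) = σ (baseIncl D n b) (F t) := by
  obtain ⟨x, hx, φ, w, g, h⟩ := exists_mem_wordCoeff_ne_zero hρ hJ σ hu
  let F : (⨂[ℂ] j, V (x j)) →ₗ[ℂ] U := PiTensorProduct.lift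
    (((LinearMap.applyₗ (σ g u)).compMultilinearMap (powAct (σ.comp (baseIncl D n)))).compLinearMap
      fun j => matCoeff (ρ (x j)) (φ j))
  have hF : ∀ v, F (PiTensorProduct.tprod ℂ v) =
      powAct (σ.comp (baseIncl D n)) (wordCoeff ρ x φ v) (σ g u) := fun v =>
    PiTensorProduct.lift.tprod v
  refine ⟨x, hx, F, fun h0 => h ?_, fun b => LinearMap.congr_fun (f := F ∘ₗ _) (g := _ ∘ₗ F) ?_⟩
  · rw [← hF, h0, LinearMap.zero_apply]
  · refine PiTensorProduct.ext (MultilinearMap.ext fun v => ?_)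
    have h1 : tensorRep ρ x (baseInclInertia D x b) (PiTensorProduct.tprod ℂ v) =
        PiTensorProduct.tprod ℂ fun j => ρ (x j) (b j) (v j) := by
      rw [← twistedRep_base_tprod ρ x 1 b v]
      exact (one_smul ℂ _).symm
    simp only [LinearMap.compMultilinearMap_apply, LinearMap.comp_apply, h1, hF]
    exact powAct_wordCoeff_map ρ _ x φ v b _

omit [NeZero n] [Fintype D] in
/-- A complex character of a group, as a homomorphism to the units. -/
def unitsCharacter {S : Type*} [CommGroup S] (ψ : AddChar (Additive S) ℂ) : S →* ℂˣ :=
  MonoidHom.toHomUnits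
    { toFun := fun s => ψ (Additive.ofMul s)
      map_one' := ψ.map_zero_eq_one
      map_mul' := fun a b => ψ.map_add_eq_mul (Additive.ofMul a) (Additive.ofMul b) }

/-- A nonzero `D^n`-equivariant map out of `⨂ j, V (x j)` can be averaged to a nonzero map that is
`D^n ⋊ S_x`-equivariant for the twist by some character of `S_x`. -/
theorem exists_inertia_equivariant (ρ : ∀ i, Representation ℂ D (V i)) (x : Cyc n → ι)
    {U : Type*} [AddCommGroup U] [Module ℂ U] (σ : Representation ℂ (D ≀ᵣ Cyc n) U)
    {F : (⨂[ℂ] j, V (x j)) →ₗ[ℂ] U} (hF0 : F ≠ 0)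
    (hF : ∀ b t, F (tensorRep ρ x (baseInclInertia D x b) t) = σ (baseIncl D n b) (F t)) :
    ∃ (τ : stab x →* ℂˣ) (K : (⨂[ℂ] j, V (x j)) →ₗ[ℂ] U), K ≠ 0 ∧
      ∀ (g : inertia D x) t, K (twistedRep ρ x τ g t) = σ g (K t) := by
  classical
  have := Fintype.ofFinite (inertia D x)
  let K : (stab x →* ℂˣ) → (⨂[ℂ] j, V (x j)) →ₗ[ℂ] U := fun τ =>
    ∑ g : inertia D x, σ g ∘ₗ F ∘ₗ twistedRep ρ x τ g⁻¹
  have hK : ∀ τ (g : inertia D x) t, K τ (twistedRep ρ x τ g t) = σ g (K τ t) := by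
    intro τ g t
    simp only [K, LinearMap.sum_apply, LinearMap.comp_apply, map_sum]
    refine Fintype.sum_equiv (Equiv.mulLeft g⁻¹) _ _ fun a => ?_
    simp [← Module.End.mul_apply, ← map_mul]
  by_contra! hall
  have hK0 : ∀ τ, K τ = 0 := fun τ => by
    by_contra h
    obtain ⟨g, t, hgt⟩ := hall τ (K τ) h
    exact hgt (hK τ g t)
  -- Orthogonality of characters leaves only the elements of the base group, each of which
  -- contributes `|S_x| • F`.
  have hsum : ∑ ψ : AddChar (Additive (stab x)) ℂ, K (unitsCharacter ψ) =
      ∑ g : inertia D x, if inertiaProj D x g = 1 then (Fintype.card (stab x) : ℂ) • F else 0 := by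
    rw [Finset.sum_comm]
    refine Finset.sum_congr rfl fun g _ => ?_
    have h1 : ∀ ψ : AddChar (Additive (stab x)) ℂ,
        σ g ∘ₗ F ∘ₗ twistedRep ρ x (unitsCharacter ψ) g⁻¹ =
          ψ (Additive.ofMul (inertiaProj D x g⁻¹)) • (σ g ∘ₗ F ∘ₗ tensorRep ρ x g⁻¹) := fun ψ => by
      rw [← LinearMap.comp_smul, ← LinearMap.comp_smul]
      rfl
    simp only [h1]
    rw [← Finset.sum_smul, AddChar.sum_apply_eq_ite]
    by_cases hg : inertiaProj D x g = 1
    · obtain ⟨b, rfl⟩ : ∃ b, baseInclInertia D x b = g :=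
        ⟨g.1.left, Subtype.ext (RegularWreathProduct.ext rfl (congrArg Subtype.val hg).symm)⟩
      rw [if_pos hg, if_pos (by rw [map_inv, hg]; simp)]
      have h2 : σ (baseIncl D n b) ∘ₗ F ∘ₗ tensorRep ρ x (baseInclInertia D x b)⁻¹ = F :=
        LinearMap.ext fun t => by
          rw [LinearMap.comp_apply, LinearMap.comp_apply, ← hF, ← Module.End.mul_apply, ← map_mul,
            mul_inv_cancel, map_one, Module.End.one_apply]
      rw [Fintype.card_additive]
      exact congrArg _ h2
    · rw [if_neg hg, if_neg (by simpa using hg), zero_smul]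
  simp only [hK0, Finset.sum_const_zero] at hsum
  rw [← Finset.sum_filter, Finset.sum_const, ← Nat.cast_smul_eq_nsmul ℂ, smul_smul] at hsum
  refine hF0 ((smul_eq_zero.1 hsum.symm).resolve_left (mul_ne_zero ?_ (by simp)))
  exact Nat.cast_ne_zero.2 (Finset.card_ne_zero.2 ⟨1, by simp⟩)

theorem exists_equiv_inducedRep {ρ : ∀ i, Representation ℂ D (V i)} (hρ : IsTraversal ρ)
    {J : Set (Cyc n → ι)} (hJ : IsOrbitReps J) {U : Type*} [AddCommGroup U] [Module ℂ U]
    (σ : Representation ℂ (D ≀ᵣ Cyc n) U) (hσ : σ.IsIrreducible) :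
    ∃ x ∈ J, ∃ τ : stab x →* ℂˣ, Nonempty (σ.Equiv (inducedRep ρ x τ)) := by
  obtain ⟨u, hu⟩ := exists_ne_zero_of_isIrreducible σ hσ
  obtain ⟨x, hx, F, hF0, hF⟩ := exists_base_equivariant hρ hJ σ hu
  obtain ⟨τ, K, hK0, hK⟩ := exists_inertia_equivariant ρ x σ hF0 hF
  obtain ⟨Φ, hΦ⟩ := exists_intertwiningMap_ind (inertia D x).subtype (twistedRep ρ x τ) σ K hK
  have : (Representation.ind (inertia D x).subtype (twistedRep ρ x τ)).IsIrreducible :=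
    isIrreducible_inducedRep hρ hJ hx τ
  refine ⟨x, hx, τ, ⟨(Φ.ofBijective
    ((Representation.IsIrreducible.bijective_or_eq_zero Φ).resolve_right fun h0 => hK0 ?_)).symm⟩⟩
  refine LinearMap.ext fun t => ?_
  rw [← hΦ, h0]
  rfl

theorem isTraversal_inducedRep {ρ : ∀ i, Representation ℂ D (V i)} (hρ : IsTraversal ρ)
    {J : Set (Cyc n → ι)} (hJ : IsOrbitReps J) :
    IsTraversal (ι := Σ x : J, (stab x.1 →* ℂˣ)) fun p => inducedRep ρ p.1.1 p.2 := by
  refine ⟨fun p => isIrreducible_inducedRep hρ hJ p.1.2 p.2, ?_, ?_⟩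
  · rintro ⟨⟨x, hx⟩, τ⟩ ⟨⟨y, hy⟩, τ'⟩ ⟨E⟩
    obtain rfl := eq_of_equiv_inducedRep_of_mem hρ hJ hx hy E
    obtain rfl := eq_of_equiv_inducedRep hρ E
    rfl
  · intro U _ _ σ hσ
    obtain ⟨x, hx, τ, hE⟩ := exists_equiv_inducedRep hρ hJ σ hσ
    exact ⟨⟨⟨x, hx⟩, τ⟩, hE⟩

end Traversal

instance finite_W (r : ℕ → ℕ+) : ∀ k, Finite (W r k)
  | 0 => (inferInstance : Finite PUnit.{1})
  | k + 1 => by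
    have := finite_W r k
    exact (inferInstance : Finite (W r k ≀ᵣ Cyc (r (k + 1))))

end CyclicWreath

end

open CyclicWreath in
theorem theorem2p1 (r : ℕ → ℕ+) (k : ℕ) (h : ℕ) {V : Fin h → Type*}
    [∀ i, AddCommGroup (V i)] [∀ i, Module ℂ (V i)]
    (ρ : ∀ i, Representation ℂ (W r k) (V i)) (hρ : IsTraversal ρ)
    (J : Set (Cyc (r (k + 1)) → Fin h)) (hJ : IsOrbitReps J) :
    IsTraversal (G := W r (k + 1)) (ι := Σ x : J, (stab x.1 →* ℂˣ))
      (fun p => inducedRep ρ p.1.1 p.2) := by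
  have := Fintype.ofFinite (W r k)
  exact isTraversal_inducedRep hρ hJ
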